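/- For $4\le n\le\infty$ let $\Lambda_2(3,3,n)=\langle x,y\mid x^3=y^3=(xy)^n=e\rangle$ (the last relation is omitted for $n=\infty$). Let $\mathrm{PU}(2,1)$ be the quotient by scalar matrices of the group $\mathrm U(2,1)$ of complex $3\times 3$ matrices preserving the Hermitian form $z_1\overline{w_1}+z_2\overline{w_2}-z_3\overline{w_3}$. An element of $\mathrm{PU}(2,1)$ is called unipotent if it is nontrivial and has a unipotent representative in $\mathrm U(2,1)$. The fundamental groups of the one-cusped hyperbolic manifolds m045, m035, m130, with a meridian $\mu$ and a longitude $\lambda$ of the cusp, are $$\pi_1(\mathrm{m045})=\langle a,b\mid a^3b^2a^3b^{-1}a^{-4}b^{-1}\rangle,\quad \mu=a^{-1}b^{-1},\ \lambda=ba^{-3}b^{-3}a^{-3},$$ $$\pi_1(\mathrm{m035})=\langle a,b\mid ab^3a^{-2}b^3ab^{-2}\rangle,\quad \mu=ab,\ \lambda=ab^3a^{-3}b^3,$$ $$\pi_1(\mathrm{m130})=\langle a,b\mid b^2a^{-1}ba^{-1}b^2a^{-1}ba^{-1}b^2a^{-4}\rangle,\quad \mu=ba^{-1}b^2,\ \lambda=b^{-1}a^3.$$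 For integers $p,q$, $\pi_1(M(p,q))=\pi_1(M)/\langle\langle\mu^p\lambda^q\rangle\rangle$ is the fundamental group of the Dehn filling $M(p,q)$ and $H_1(M(p,q))$ is its abelianization. The boundary unipotent representations m045-1, m035-1 and m130-1 are, up to conjugation and complex conjugation, the following representations $\xi\colon\pi_1(M)\to\mathrm{PU}(2,1)$. With $w=\sqrt{-7}$, m045-1 is $$a\mapsto\tfrac14\begin{pmatrix}3+w&1-w&1-w\\1+w&-4&-1-w\\1-w&-1+w&-5+w\end{pmatrix},\quad b\mapsto\tfrac12\begin{pmatrix}-w&1-w&-2-w\\1+w&-2&1+w\\-2-w&1-w&-4-w\end{pmatrix}.$$ With $w=\sqrt{-15}$, both m035-1 and m130-1 send $$a\mapsto\tfrac16\begin{pmatrix}3+w&6&3+w\\9+3w&-3-3w&18\\-12+2w&12&-3+5w\end{pmatrix},$$ and they send $b$ respectively to $$\tfrac16\begin{pmatrix}-6+2w&18&3+5w\\-6-6w&-21+3w&-24-6w\\24-2w&-18-6w&24-8w\end{pmatrix},\qquad \tfrac16\begin{pmatrix}6+2w&18&-3+5w\\-6&6+6w&-24\\-6-2w&-27+3w&-6-8w\end{pmatrix}.$$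 Proposition. Each of these three representations $\xi$ is boundary unipotent (the image of $\langle\mu,\lambda\rangle$ is an abelian group generated by one or two unipotent elements), of rank one (one unipotent element generates the image), and $\xi$ factors through $\pi_1$ of the Dehn filling $\mathrm{m045}(5,1)$, $\mathrm{m035}(3,-1)$, $\mathrm{m130}(2,-1)$ respectively. The first homology groups of these fillings are isomorphic to $\mathbb Z/14$, $\mathbb Z/20$ and $\mathbb Z/16$. The abelianization of $\Lambda_2(3,3,n)$ is isomorphic to $\mathbb Z/3$ if $n$ is finite and not divisible by $3$, and to $\mathbb Z/3\oplus\mathbb Z/3$ if $n$ is divisible by $3$ or $n=\infty$. For each of the three fillings $N$ and each $4\le n\le\infty$, there is no surjective morphism $H_1(N)\to\Lambda_2(3,3,n)^{\mathrm{ab}}$ and no surjective morphism $\pi_1(N)\to\Lambda_2(3,3,n)$. Consequently $\xi$ does not arise from a surjective morphism $\pi_1(M)\to\Lambda_2(3,3,n)$, for any $4\le n\le\infty$: there are no surjective morphism $\rho\colon\pi_1(M)\to\Lambda_2(3,3,n)$ and representation $\delta\colon\Lambda_2(3,3,n)\to\mathrm{PU}(2,1)$ (faithful or not) with $\xi=\delta\circ\rho$;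 moreover the image of $\xi$ is not the image of any representation $\Lambda_2(3,3,n)\to\mathrm{PU}(2,1)$. -/

import Mathlib

namespace TriangleRep

open Matrix

/-! ## The group `PU(2,1)` -/

/-- The matrix of the Hermitian form `z₁ w̄₁ + z₂ w̄₂ - z₃ w̄₃` of signature `(2,1)`. -/
def J21 : Matrix (Fin 3) (Fin 3) ℂ := Matrix.diagonal ![1, 1, -1]

theorem J21_mul_J21 : J21 * J21 = 1 := by
  rw [J21, Matrix.diagonal_mul_diagonal, ← Matrix.diagonal_one]
  congr 1
  ext i
  fin_cases i <;> simp

/-- `U(2,1)`: the invertible matrices that preserve the Hermitian form. -/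
def U21 : Subgroup (GL (Fin 3) ℂ) where
  carrier := {g | (g : Matrix (Fin 3) (Fin 3) ℂ)ᴴ * J21 * (g : Matrix (Fin 3) (Fin 3) ℂ) = J21}
  one_mem' := by simp
  mul_mem' := by
    intro g h hg hh
    simp only [Set.mem_ofPred_eq, Units.val_mul, Matrix.conjTranspose_mul] at *
    calc _ = (h : Matrix (Fin 3) (Fin 3) ℂ)ᴴ *
          ((g : Matrix (Fin 3) (Fin 3) ℂ)ᴴ * J21 * (g : Matrix (Fin 3) (Fin 3) ℂ)) *
          (h : Matrix (Fin 3) (Fin 3) ℂ) := by simp only [Matrix.mul_assoc]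
      _ = _ := by rw [hg, hh]
  inv_mem' := by
    intro g hg
    simp only [Set.mem_ofPred_eq] at *
    have h1 : (g : Matrix (Fin 3) (Fin 3) ℂ) * ((g⁻¹ : GL (Fin 3) ℂ) : Matrix (Fin 3) (Fin 3) ℂ)
        = 1 := by rw [← Units.val_mul, mul_inv_cancel, Units.val_one]
    have h2 : ((g⁻¹ : GL (Fin 3) ℂ) : Matrix (Fin 3) (Fin 3) ℂ)ᴴ *
        (g : Matrix (Fin 3) (Fin 3) ℂ)ᴴ = 1 := by
      rw [← Matrix.conjTranspose_mul, h1, Matrix.conjTranspose_one]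
    calc _ = ((g⁻¹ : GL (Fin 3) ℂ) : Matrix (Fin 3) (Fin 3) ℂ)ᴴ *
          ((g : Matrix (Fin 3) (Fin 3) ℂ)ᴴ * J21 * (g : Matrix (Fin 3) (Fin 3) ℂ)) *
          ((g⁻¹ : GL (Fin 3) ℂ) : Matrix (Fin 3) (Fin 3) ℂ) := by rw [hg]
      _ = (((g⁻¹ : GL (Fin 3) ℂ) : Matrix (Fin 3) (Fin 3) ℂ)ᴴ *
          (g : Matrix (Fin 3) (Fin 3) ℂ)ᴴ) * J21 * ((g : Matrix (Fin 3) (Fin 3) ℂ) *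
          ((g⁻¹ : GL (Fin 3) ℂ) : Matrix (Fin 3) (Fin 3) ℂ)) := by
            simp only [Matrix.mul_assoc]
      _ = J21 := by rw [h1, h2, Matrix.one_mul, Matrix.mul_one]

/-- `PU(2,1)`: the group `U(2,1)` modulo its scalar matrices (the center of `GL₃(ℂ)` consists of
the scalar matrices). -/
abbrev PU21 : Type := U21 ⧸ (Subgroup.center (GL (Fin 3) ℂ)).subgroupOf U21

/-- A matrix preserving the Hermitian form, as an element of `U(2,1)`. -/
def mkU21 (g : Matrix (Fin 3) (Fin 3) ℂ) (hg : gᴴ * J21 * g = J21) : U21 :=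
  ⟨⟨g, J21 * gᴴ * J21,
    mul_eq_one_comm.mp (by rw [Matrix.mul_assoc, Matrix.mul_assoc, ← Matrix.mul_assoc gᴴ, hg,
      J21_mul_J21]),
    by rw [Matrix.mul_assoc, Matrix.mul_assoc, ← Matrix.mul_assoc gᴴ, hg, J21_mul_J21]⟩, hg⟩

/-- An element of `PU(2,1)` is unipotent if it is nontrivial and is represented by a unipotent
matrix. -/
def IsUnipotent (g : PU21) : Prop :=
  g ≠ 1 ∧ ∃ u : U21, (QuotientGroup.mk u : PU21) = g ∧
    IsNilpotent (((u : GL (Fin 3) ℂ) : Matrix (Fin 3) (Fin 3) ℂ) - 1)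

/-! ## The groups `Λ₂(p,q,r)` -/

/-- The relation `w ^ n = e`, which is omitted when `n = ∞`. -/
def powRel (w : FreeGroup (Fin 2)) (n : ℕ∞) : Set (FreeGroup (Fin 2)) :=
  {v | ∃ k : ℕ, n = (k : ℕ∞) ∧ v = w ^ k}

/-- `Λ₂(p,q,r) = ⟨x, y | x ^ p = y ^ q = (x y) ^ r = e⟩`. -/
abbrev Lambda2 (p q r : ℕ∞) : Type :=
  PresentedGroup (powRel (FreeGroup.of (0 : Fin 2)) p ∪ powRel (FreeGroup.of (1 : Fin 2)) q ∪
    powRel (FreeGroup.of (0 : Fin 2) * FreeGroup.of (1 : Fin 2)) r)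

/-! ## Fundamental groups of one-cusped manifolds and of their Dehn fillings -/

/-- A presentation with two generators and one relator of the fundamental group of a one-cusped
manifold, with words for the meridian and the longitude of the cusp. -/
structure CuspedPresentation where
  relator : FreeGroup (Fin 2)
  meridian : FreeGroup (Fin 2)
  longitude : FreeGroup (Fin 2)

namespace CuspedPresentation

variable (M : CuspedPresentation)

/-- The fundamental group `π₁(M)`. -/
abbrev Pi1 : Type := PresentedGroup ({M.relator} : Set (FreeGroup (Fin 2)))

/-- The meridian in `π₁(M)`. -/
def mer : M.Pi1 := PresentedGroup.mk {M.relator} M.meridian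

/-- The longitude in `π₁(M)`. -/
def lon : M.Pi1 := PresentedGroup.mk {M.relator} M.longitude

/-- The peripheral subgroup of the cusp. -/
def peripheral : Subgroup M.Pi1 := Subgroup.closure {M.mer, M.lon}

/-- The fundamental group of the Dehn filling `M(p,q)`: one adds to `π₁(M)` the relation
`mer ^ p * lon ^ q = e`. -/
abbrev FillingPi1 (p q : ℤ) : Type :=
  M.Pi1 ⧸ Subgroup.normalClosure ({M.mer ^ p * M.lon ^ q} : Set M.Pi1)

/-- The projection from `π₁(M)` to the fundamental group of the Dehn filling `M(p,q)`. -/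
def toFilling (p q : ℤ) : M.Pi1 →* M.FillingPi1 p q :=
  QuotientGroup.mk' (Subgroup.normalClosure ({M.mer ^ p * M.lon ^ q} : Set M.Pi1))

variable {M}

/-- A representation is boundary unipotent if the peripheral subgroup is sent to an abelian
subgroup of `PU(2,1)` generated by one or two unipotent elements. -/
def IsBoundaryUnipotent (ξ : M.Pi1 →* PU21) : Prop :=
  ∃ u v : PU21, IsUnipotent u ∧ IsUnipotent v ∧ Commute u v ∧
    M.peripheral.map ξ = Subgroup.closure {u, v}

/-- The boundary unipotent holonomy has rank one: it is generated by one unipotent element. -/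
def IsRankOneBoundaryUnipotent (ξ : M.Pi1 →* PU21) : Prop :=
  ∃ u : PU21, IsUnipotent u ∧ M.peripheral.map ξ = Subgroup.zpowers u

/-- The representation factors through the fundamental group of the Dehn filling `M(p,q)`. -/
def FactorsThroughFilling (ξ : M.Pi1 →* PU21) (p q : ℤ) : Prop :=
  ∃ ξ' : M.FillingPi1 p q →* PU21, ξ = ξ'.comp (M.toFilling p q)

/-- The representation arises from a surjective morphism `ρ : π₁(M) → Λ₂(3,3,n)`: it is the
composition of `ρ` with some representation `δ` of `Λ₂(3,3,n)` in `PU(2,1)`. -/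
def ArisesFromLambda2 (ξ : M.Pi1 →* PU21) (n : ℕ∞) : Prop :=
  ∃ (ρ : M.Pi1 →* Lambda2 3 3 n) (δ : Lambda2 3 3 n →* PU21),
    Function.Surjective ρ ∧ ξ = δ.comp ρ

end CuspedPresentation

/-! ## The three manifolds -/

/-- `π₁(m045) = ⟨a, b | a³ b² a³ b⁻¹ a⁻⁴ b⁻¹⟩`, with meridian `a⁻¹ b⁻¹` and longitude
`b a⁻³ b⁻³ a⁻³`. -/
def m045 : CuspedPresentation :=
  let a : FreeGroup (Fin 2) := FreeGroup.of 0
  let b : FreeGroup (Fin 2) := FreeGroup.of 1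
  { relator := a ^ 3 * b ^ 2 * a ^ 3 * b⁻¹ * a⁻¹ ^ 4 * b⁻¹
    meridian := a⁻¹ * b⁻¹
    longitude := b * a⁻¹ ^ 3 * b⁻¹ ^ 3 * a⁻¹ ^ 3 }

/-- `π₁(m035) = ⟨a, b | a b³ a⁻² b³ a b⁻²⟩`, with meridian `a b` and longitude
`a b³ a⁻³ b³`. -/
def m035 : CuspedPresentation :=
  let a : FreeGroup (Fin 2) := FreeGroup.of 0
  let b : FreeGroup (Fin 2) := FreeGroup.of 1
  { relator := a * b ^ 3 * a⁻¹ ^ 2 * b ^ 3 * a * b⁻¹ ^ 2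
    meridian := a * b
    longitude := a * b ^ 3 * a⁻¹ ^ 3 * b ^ 3 }

/-- `π₁(m130) = ⟨a, b | b² a⁻¹ b a⁻¹ b² a⁻¹ b a⁻¹ b² a⁻⁴⟩`, with meridian `b a⁻¹ b²` and
longitude `b⁻¹ a³`. -/
def m130 : CuspedPresentation :=
  let a : FreeGroup (Fin 2) := FreeGroup.of 0
  let b : FreeGroup (Fin 2) := FreeGroup.of 1
  { relator := b ^ 2 * a⁻¹ * b * a⁻¹ * b ^ 2 * a⁻¹ * b * a⁻¹ * b ^ 2 * a⁻¹ ^ 4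
    meridian := b * a⁻¹ * b ^ 2
    longitude := b⁻¹ * a ^ 3 }

/-! ## The three representations -/

/-- `√-7`, with positive imaginary part. -/
noncomputable def w7 : ℂ := (Real.sqrt 7 : ℂ) * Complex.I

/-- `√-15`, with positive imaginary part. -/
noncomputable def w15 : ℂ := (Real.sqrt 15 : ℂ) * Complex.I

/-- The matrix of the image of `a` under the representation m045-1. -/
noncomputable def matA045 : Matrix (Fin 3) (Fin 3) ℂ :=
  (1 / 4 : ℂ) • !![3 + w7, 1 - w7, 1 - w7;
                   1 + w7, -4, -1 - w7;
                   1 - w7, -1 + w7, -5 + w7]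

/-- The matrix of the image of `b` under the representation m045-1. -/
noncomputable def matB045 : Matrix (Fin 3) (Fin 3) ℂ :=
  (1 / 2 : ℂ) • !![-w7, 1 - w7, -2 - w7;
                   1 + w7, -2, 1 + w7;
                   -2 - w7, 1 - w7, -4 - w7]

/-- The matrix of the image of `a` under the representation m035-1. -/
noncomputable def matA035 : Matrix (Fin 3) (Fin 3) ℂ :=
  (1 / 6 : ℂ) • !![3 + w15, 6, 3 + w15;
                   9 + 3 * w15, -3 - 3 * w15, 18;
                   -12 + 2 * w15, 12, -3 + 5 * w15]

/-- The matrix of the image of `b` under the representation m035-1. -/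
noncomputable def matB035 : Matrix (Fin 3) (Fin 3) ℂ :=
  (1 / 6 : ℂ) • !![-6 + 2 * w15, 18, 3 + 5 * w15;
                   -6 - 6 * w15, -21 + 3 * w15, -24 - 6 * w15;
                   24 - 2 * w15, -18 - 6 * w15, 24 - 8 * w15]

/-- The matrix of the image of `a` under the representation m130-1. -/
noncomputable def matA130 : Matrix (Fin 3) (Fin 3) ℂ :=
  (1 / 6 : ℂ) • !![3 + w15, 6, 3 + w15;
                   9 + 3 * w15, -3 - 3 * w15, 18;
                   -12 + 2 * w15, 12, -3 + 5 * w15]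

/-- The matrix of the image of `b` under the representation m130-1. -/
noncomputable def matB130 : Matrix (Fin 3) (Fin 3) ℂ :=
  (1 / 6 : ℂ) • !![6 + 2 * w15, 18, -3 + 5 * w15;
                   -6, 6 + 6 * w15, -24;
                   -6 - 2 * w15, -27 + 3 * w15, -6 - 8 * w15]

theorem w7_mul_self : w7 * w7 = ((-7 : ℤ) : ℂ) := by
  have h : ((Real.sqrt 7 : ℝ) : ℂ) * ((Real.sqrt 7 : ℝ) : ℂ) = 7 := by
    rw [← Complex.ofReal_mul, Real.mul_self_sqrt (by norm_num)]; norm_num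
  rw [w7, mul_mul_mul_comm, h, Complex.I_mul_I]; norm_num

theorem w15_mul_self : w15 * w15 = ((-15 : ℤ) : ℂ) := by
  have h : ((Real.sqrt 15 : ℝ) : ℂ) * ((Real.sqrt 15 : ℝ) : ℂ) = 15 := by
    rw [← Complex.ofReal_mul, Real.mul_self_sqrt (by norm_num)]; norm_num
  rw [w15, mul_mul_mul_comm, h, Complex.I_mul_I]; norm_num

theorem star_w7 : star w7 = -w7 := by
  simp [w7]

theorem star_w15 : star w15 = -w15 := by
  simp [w15]

/-- The ring homomorphism `ℤ[√d] → ℂ` that sends `√d` to `w`. -/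
noncomputable def toC (d : ℤ) (w : ℂ) (hw : w * w = (d : ℂ)) : ℤ√d →+* ℂ :=
  Zsqrtd.lift ⟨w, hw⟩

theorem toC_apply (d : ℤ) (w : ℂ) (hw : w * w = (d : ℂ)) (z : ℤ√d) :
    toC d w hw z = (z.re : ℂ) + (z.im : ℂ) * w := rfl

theorem toC_star (d : ℤ) (w : ℂ) (hw : w * w = (d : ℂ)) (hs : star w = -w) (z : ℤ√d) :
    toC d w hw (star z) = star (toC d w hw z) := by
  rw [toC_apply, toC_apply, star_add, star_mul', hs]
  simp

/-- The Hermitian form over `ℤ[√d]`. -/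
def JZ (d : ℤ) : Matrix (Fin 3) (Fin 3) (ℤ√d) := Matrix.diagonal ![1, 1, -1]

theorem toC_JZ (d : ℤ) (w : ℂ) (hw : w * w = (d : ℂ)) :
    (toC d w hw).mapMatrix (JZ d) = J21 := by
  ext i j
  fin_cases i <;> fin_cases j <;> simp [JZ, J21]

theorem toC_conjTranspose (d : ℤ) (w : ℂ) (hw : w * w = (d : ℂ)) (hs : star w = -w)
    (A : Matrix (Fin 3) (Fin 3) (ℤ√d)) :
    ((toC d w hw).mapMatrix A)ᴴ = (toC d w hw).mapMatrix Aᴴ := by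
  ext i j
  simp only [RingHom.mapMatrix_apply, Matrix.conjTranspose_apply, Matrix.map_apply]
  rw [toC_star d w hw hs]

theorem isUnitary_of_int (d : ℤ) (w : ℂ) (hw : w * w = (d : ℂ)) (hs : star w = -w)
    (A : Matrix (Fin 3) (Fin 3) (ℤ√d)) (N : ℕ) (hN : N ≠ 0)
    (hA : Aᴴ * JZ d * A = (N ^ 2) • JZ d) :
    ((1 / (N : ℂ)) • (toC d w hw).mapMatrix A)ᴴ * J21 * ((1 / (N : ℂ)) • (toC d w hw).mapMatrix A)
      = J21 := by
  have hN' : (N : ℂ) ≠ 0 := by exact_mod_cast hN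
  rw [Matrix.conjTranspose_smul, toC_conjTranspose d w hw hs, ← toC_JZ d w hw, smul_mul_assoc,
    smul_mul_assoc, mul_smul_comm, smul_smul, ← map_mul, ← map_mul, hA, map_nsmul,
    ← Nat.cast_smul_eq_nsmul ℂ, smul_smul]
  have : star (1 / (N : ℂ)) * (1 / (N : ℂ)) * ((N ^ 2 : ℕ) : ℂ) = 1 := by
    simp
    field_simp
  rw [this, one_smul]

/-- The matrix `4 • matA045` over `ℤ[√-7]`. -/
def intA045 : Matrix (Fin 3) (Fin 3) (ℤ√(-7)) :=
  !![⟨3, 1⟩, ⟨1, -1⟩, ⟨1, -1⟩;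
     ⟨1, 1⟩, ⟨-4, 0⟩, ⟨-1, -1⟩;
     ⟨1, -1⟩, ⟨-1, 1⟩, ⟨-5, 1⟩]

theorem matA045_eq : matA045 = (1 / ((4 : ℕ) : ℂ)) • (toC (-7) w7 w7_mul_self).mapMatrix intA045 := by
  ext i j
  fin_cases i <;> fin_cases j <;> simp [matA045, intA045, toC_apply] <;> ring

theorem matA045_unitary : matA045ᴴ * J21 * matA045 = J21 := by
  rw [matA045_eq]
  exact isUnitary_of_int _ _ _ star_w7 _ 4 (by norm_num) (by decide +kernel)

/-- The matrix `2 • matB045` over `ℤ[√-7]`. -/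
def intB045 : Matrix (Fin 3) (Fin 3) (ℤ√(-7)) :=
  !![⟨0, -1⟩, ⟨1, -1⟩, ⟨-2, -1⟩;
     ⟨1, 1⟩, ⟨-2, 0⟩, ⟨1, 1⟩;
     ⟨-2, -1⟩, ⟨1, -1⟩, ⟨-4, -1⟩]

theorem matB045_eq : matB045 = (1 / ((2 : ℕ) : ℂ)) • (toC (-7) w7 w7_mul_self).mapMatrix intB045 := by
  ext i j
  fin_cases i <;> fin_cases j <;> simp [matB045, intB045, toC_apply] <;> ring

theorem matB045_unitary : matB045ᴴ * J21 * matB045 = J21 := by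
  rw [matB045_eq]
  exact isUnitary_of_int _ _ _ star_w7 _ 2 (by norm_num) (by decide +kernel)

/-- The matrix `6 • matA035` over `ℤ[√-15]`. -/
def intA035 : Matrix (Fin 3) (Fin 3) (ℤ√(-15)) :=
  !![⟨3, 1⟩, ⟨6, 0⟩, ⟨3, 1⟩;
     ⟨9, 3⟩, ⟨-3, -3⟩, ⟨18, 0⟩;
     ⟨-12, 2⟩, ⟨12, 0⟩, ⟨-3, 5⟩]

theorem matA035_eq : matA035 = (1 / ((6 : ℕ) : ℂ)) • (toC (-15) w15 w15_mul_self).mapMatrix intA035 := by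
  ext i j
  fin_cases i <;> fin_cases j <;> simp [matA035, intA035, toC_apply] <;> ring

theorem matA035_unitary : matA035ᴴ * J21 * matA035 = J21 := by
  rw [matA035_eq]
  exact isUnitary_of_int _ _ _ star_w15 _ 6 (by norm_num) (by decide +kernel)

/-- The matrix `6 • matB035` over `ℤ[√-15]`. -/
def intB035 : Matrix (Fin 3) (Fin 3) (ℤ√(-15)) :=
  !![⟨-6, 2⟩, ⟨18, 0⟩, ⟨3, 5⟩;
     ⟨-6, -6⟩, ⟨-21, 3⟩, ⟨-24, -6⟩;
     ⟨24, -2⟩, ⟨-18, -6⟩, ⟨24, -8⟩]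

theorem matB035_eq : matB035 = (1 / ((6 : ℕ) : ℂ)) • (toC (-15) w15 w15_mul_self).mapMatrix intB035 := by
  ext i j
  fin_cases i <;> fin_cases j <;> simp [matB035, intB035, toC_apply] <;> ring

theorem matB035_unitary : matB035ᴴ * J21 * matB035 = J21 := by
  rw [matB035_eq]
  exact isUnitary_of_int _ _ _ star_w15 _ 6 (by norm_num) (by decide +kernel)

/-- The matrix `6 • matB130` over `ℤ[√-15]`. -/
def intB130 : Matrix (Fin 3) (Fin 3) (ℤ√(-15)) :=
  !![⟨6, 2⟩, ⟨18, 0⟩, ⟨-3, 5⟩;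
     ⟨-6, 0⟩, ⟨6, 6⟩, ⟨-24, 0⟩;
     ⟨-6, -2⟩, ⟨-27, 3⟩, ⟨-6, -8⟩]

theorem matB130_eq : matB130 = (1 / ((6 : ℕ) : ℂ)) • (toC (-15) w15 w15_mul_self).mapMatrix intB130 := by
  ext i j
  fin_cases i <;> fin_cases j <;> simp [matB130, intB130, toC_apply] <;> ring

theorem matB130_unitary : matB130ᴴ * J21 * matB130 = J21 := by
  rw [matB130_eq]
  exact isUnitary_of_int _ _ _ star_w15 _ 6 (by norm_num) (by decide +kernel)

theorem matA130_unitary : matA130ᴴ * J21 * matA130 = J21 := matA035_unitary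

theorem inv_of_int (d : ℤ) (w : ℂ) (hw : w * w = (d : ℂ)) (hs : star w = -w)
    (A : Matrix (Fin 3) (Fin 3) (ℤ√d)) (N : ℕ) :
    J21 * ((1 / (N : ℂ)) • (toC d w hw).mapMatrix A)ᴴ * J21 =
      (1 / (N : ℂ)) • (toC d w hw).mapMatrix (JZ d * Aᴴ * JZ d) := by
  rw [Matrix.conjTranspose_smul, toC_conjTranspose d w hw hs, ← toC_JZ d w hw, mul_smul_comm,
    smul_mul_assoc, ← map_mul, ← map_mul]
  congr 1
  simp

/-- The images of the generators in `U(2,1)`. -/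
noncomputable def genA045 : U21 := mkU21 matA045 matA045_unitary

noncomputable def genB045 : U21 := mkU21 matB045 matB045_unitary

noncomputable def genA035 : U21 := mkU21 matA035 matA035_unitary

noncomputable def genB035 : U21 := mkU21 matB035 matB035_unitary

noncomputable def genA130 : U21 := mkU21 matA130 matA130_unitary

noncomputable def genB130 : U21 := mkU21 matB130 matB130_unitary

theorem rel045 :
    genA045 ^ 3 * genB045 ^ 2 * genA045 ^ 3 * genB045⁻¹ * genA045⁻¹ ^ 4 * genB045⁻¹ = 1 := by
  apply Subtype.ext
  apply Units.ext
  change matA045 ^ 3 * matB045 ^ 2 * matA045 ^ 3 * (J21 * matB045ᴴ * J21) * (J21 * matA045ᴴ * J21) ^ 4 * (J21 * matB045ᴴ * J21) = 1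
  rw [matA045_eq, matB045_eq, inv_of_int _ _ _ star_w7, inv_of_int _ _ _ star_w7]
  simp only [smul_pow, smul_mul_smul_comm, ← map_pow, ← map_mul]
  have h : intA045 ^ 3 * intB045 ^ 2 * intA045 ^ 3 * (JZ (-7) * intB045ᴴ * JZ (-7)) * (JZ (-7) * intA045ᴴ * JZ (-7)) ^ 4 * (JZ (-7) * intB045ᴴ * JZ (-7)) =
      ((4 ^ 10 * 2 ^ 4 : ℤ) : Matrix (Fin 3) (Fin 3) (ℤ√(-7))) := by
    decide +kernel
  rw [h, map_intCast]
  ext i j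
  fin_cases i <;> fin_cases j <;> norm_num [Matrix.smul_apply, Matrix.ofNat_apply]

theorem rel035 :
    genA035 * genB035 ^ 3 * genA035⁻¹ ^ 2 * genB035 ^ 3 * genA035 * genB035⁻¹ ^ 2 = 1 := by
  apply Subtype.ext
  apply Units.ext
  change matA035 * matB035 ^ 3 * (J21 * matA035ᴴ * J21) ^ 2 * matB035 ^ 3 * matA035 * (J21 * matB035ᴴ * J21) ^ 2 = 1
  rw [matA035_eq, matB035_eq, inv_of_int _ _ _ star_w15, inv_of_int _ _ _ star_w15]
  simp only [smul_pow, smul_mul_smul_comm, ← map_pow, ← map_mul]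
  have h : intA035 * intB035 ^ 3 * (JZ (-15) * intA035ᴴ * JZ (-15)) ^ 2 * intB035 ^ 3 * intA035 * (JZ (-15) * intB035ᴴ * JZ (-15)) ^ 2 =
      ((6 ^ 4 * 6 ^ 8 : ℤ) : Matrix (Fin 3) (Fin 3) (ℤ√(-15))) := by
    decide +kernel
  rw [h, map_intCast]
  ext i j
  fin_cases i <;> fin_cases j <;> norm_num [Matrix.smul_apply, Matrix.ofNat_apply]

theorem rel130 :
    genB130 ^ 2 * genA130⁻¹ * genB130 * genA130⁻¹ * genB130 ^ 2 * genA130⁻¹ * genB130 * genA130⁻¹ * genB130 ^ 2 * genA130⁻¹ ^ 4 = 1 := by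
  apply Subtype.ext
  apply Units.ext
  change matB130 ^ 2 * (J21 * matA130ᴴ * J21) * matB130 * (J21 * matA130ᴴ * J21) * matB130 ^ 2 * (J21 * matA130ᴴ * J21) * matB130 * (J21 * matA130ᴴ * J21) * matB130 ^ 2 * (J21 * matA130ᴴ * J21) ^ 4 = 1
  rw [show matA130 = matA035 from rfl]
  rw [matA035_eq, matB130_eq, inv_of_int _ _ _ star_w15]
  simp only [smul_pow, smul_mul_smul_comm, ← map_pow, ← map_mul]
  have h : intB130 ^ 2 * (JZ (-15) * intA035ᴴ * JZ (-15)) * intB130 * (JZ (-15) * intA035ᴴ * JZ (-15)) * intB130 ^ 2 * (JZ (-15) * intA035ᴴ * JZ (-15)) * intB130 * (JZ (-15) * intA035ᴴ * JZ (-15)) * intB130 ^ 2 * (JZ (-15) * intA035ᴴ * JZ (-15)) ^ 4 =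
      ((6 ^ 8 * 6 ^ 8 : ℤ) : Matrix (Fin 3) (Fin 3) (ℤ√(-15))) := by
    decide +kernel
  rw [h, map_intCast]
  ext i j
  fin_cases i <;> fin_cases j <;> norm_num [Matrix.smul_apply, Matrix.ofNat_apply]

/-- The representation m045-1, `a ↦ [matA045]`, `b ↦ [matB045]`. -/
noncomputable def rep045 : m045.Pi1 →* PU21 :=
  PresentedGroup.toGroup (f := ![QuotientGroup.mk genA045, QuotientGroup.mk genB045]) (by
    intro r hr
    rw [Set.mem_singleton_iff.mp hr]
    simp only [m045, map_mul, map_pow, map_inv, FreeGroup.lift_apply_of]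
    exact congrArg (QuotientGroup.mk' ((Subgroup.center (GL (Fin 3) ℂ)).subgroupOf U21)) rel045)

/-- The representation m035-1, `a ↦ [matA035]`, `b ↦ [matB035]`. -/
noncomputable def rep035 : m035.Pi1 →* PU21 :=
  PresentedGroup.toGroup (f := ![QuotientGroup.mk genA035, QuotientGroup.mk genB035]) (by
    intro r hr
    rw [Set.mem_singleton_iff.mp hr]
    simp only [m035, map_mul, map_pow, map_inv, FreeGroup.lift_apply_of]
    exact congrArg (QuotientGroup.mk' ((Subgroup.center (GL (Fin 3) ℂ)).subgroupOf U21)) rel035)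

/-- The representation m130-1, `a ↦ [matA130]`, `b ↦ [matB130]`. -/
noncomputable def rep130 : m130.Pi1 →* PU21 :=
  PresentedGroup.toGroup (f := ![QuotientGroup.mk genA130, QuotientGroup.mk genB130]) (by
    intro r hr
    rw [Set.mem_singleton_iff.mp hr]
    simp only [m130, map_mul, map_pow, map_inv, FreeGroup.lift_apply_of]
    exact congrArg (QuotientGroup.mk' ((Subgroup.center (GL (Fin 3) ℂ)).subgroupOf U21)) rel130)

end TriangleRep

namespace TriangleRep

/-! ## Recognizing finite abelian groups -/

/-! Three arguments are combined.

Homology. Each filling has abelianization generated by `a` and `b` with two linear relations, of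
determinant `14`, `20` or `16` up to sign, and one generator suffices, so it is cyclic of order
prime to `3`. Every `Λ₂(3,3,n)` has a character onto `ℤ/3` (`Lambda2.toZMod`), so neither the
filling group nor its homology maps onto the corresponding object.

Peripheral holonomy. Computations over `ℤ[√-7]` and `ℤ[√-15]`, with denominators cleared, show that
the meridian is unipotent and that the slope word is the identity matrix. The longitude occurs in
the slope with exponent `±1`, so its image is a power of that of the meridian; this gives rank one
and the factorization.

Image. That `ξ` factors through the filling does not make `ρ` factor through it, so homology alone
does not exclude `ξ = δ ∘ ρ`. Instead, the image of `ξ` carries a sign character. At a ramified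
prime (`√-7 ↦ 0` in `𝔽₇`, `√-15 ↦ 0` in `𝔽₅`) complex conjugation becomes trivial, the Hermitian
form becomes `x² + y² - z²`, and the image acts on the `8` or `6` points of a conic. Both generators
act by odd permutations, whereas an element whose cube is trivial has sign `1`; hence two such
elements cannot generate the image (`Lambda2.range_ne_of_sign`,
`CuspedPresentation.range_ne_of_permutesLines`). This also excludes every factorization through a
surjective `ρ`. -/

theorem nonempty_mulEquiv_zmod {C : Type*} [CommGroup C] {m : ℕ} (f : C →* Multiplicative (ZMod m))
    (t : C) (ht : t ^ m = 1) (hf : f t = Multiplicative.ofAdd 1)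
    (hgen : ∀ g : C, g ∈ Subgroup.zpowers t) : Nonempty (C ≃* Multiplicative (ZMod m)) := by
  have hfk : ∀ k : ℤ, f (t ^ k) = Multiplicative.ofAdd (k : ZMod m) := fun k => by
    rw [map_zpow, hf, ← ofAdd_zsmul, zsmul_one]
  refine ⟨MulEquiv.ofBijective f ⟨(injective_iff_map_eq_one f).mpr fun g hg => ?_, fun z => ?_⟩⟩
  · obtain ⟨k, rfl⟩ := Subgroup.mem_zpowers_iff.mp (hgen g)
    rw [hfk, ofAdd_eq_one, ZMod.intCast_zmod_eq_zero_iff_dvd] at hg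
    obtain ⟨l, rfl⟩ := hg
    rw [zpow_mul, zpow_natCast, ht, one_zpow]
  · obtain ⟨k, hk⟩ := ZMod.intCast_surjective z.toAdd
    exact ⟨t ^ k, by rw [hfk, hk, ofAdd_toAdd]⟩

theorem nonempty_mulEquiv_zmod_prod {C : Type*} [CommGroup C] {m n : ℕ}
    (f : C →* Multiplicative (ZMod m × ZMod n)) (s t : C) (hs : s ^ m = 1) (ht : t ^ n = 1)
    (hfs : f s = Multiplicative.ofAdd (1, 0)) (hft : f t = Multiplicative.ofAdd (0, 1))
    (hgen : ∀ g : C, g ∈ Subgroup.closure {s, t}) :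
    Nonempty (C ≃* Multiplicative (ZMod m × ZMod n)) := by
  have hfk : ∀ k l : ℤ, f (s ^ k * t ^ l) =
      Multiplicative.ofAdd ((k : ZMod m), (l : ZMod n)) := fun k l => by
    rw [map_mul, map_zpow, map_zpow, hfs, hft, ← ofAdd_zsmul, ← ofAdd_zsmul, ← ofAdd_add]
    simp
  refine ⟨MulEquiv.ofBijective f ⟨(injective_iff_map_eq_one f).mpr fun g hg => ?_, fun z => ?_⟩⟩
  · obtain ⟨k, l, rfl⟩ := Subgroup.mem_closure_pair.mp (hgen g)
    rw [hfk, ofAdd_eq_one, Prod.mk_eq_zero, ZMod.intCast_zmod_eq_zero_iff_dvd,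
      ZMod.intCast_zmod_eq_zero_iff_dvd] at hg
    obtain ⟨⟨i, rfl⟩, ⟨j, rfl⟩⟩ := hg
    rw [zpow_mul, zpow_mul, zpow_natCast, zpow_natCast, hs, ht, one_zpow, one_zpow, one_mul]
  · obtain ⟨k, hk⟩ := ZMod.intCast_surjective z.toAdd.1
    obtain ⟨l, hl⟩ := ZMod.intCast_surjective z.toAdd.2
    exact ⟨s ^ k * t ^ l, by rw [hfk, hk, hl, Prod.mk.eta, ofAdd_toAdd]⟩

/-- If a surjection from the free group on two generators sends both of them to a subgroup, the
subgroup is everything. -/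
theorem mem_of_freeGroup_surjective {G : Type*} [Group G] (θ : FreeGroup (Fin 2) →* G)
    (hθ : Function.Surjective θ) (H : Subgroup G) (h0 : θ (FreeGroup.of 0) ∈ H)
    (h1 : θ (FreeGroup.of 1) ∈ H) (g : G) : g ∈ H := by
  obtain ⟨w, rfl⟩ := hθ g
  induction w using FreeGroup.induction_on with
  | C1 => simp
  | of i => fin_cases i <;> assumption
  | inv_of i hi => rw [map_inv]; exact H.inv_mem hi
  | mul x y hx hy => rw [map_mul]; exact H.mul_mem hx hy

/-! ## The groups `Λ₂(3,3,n)` and their abelianizations -/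

namespace Lambda2

variable {n : ℕ∞}

theorem of_zero_pow_three : (PresentedGroup.of 0 : Lambda2 3 3 n) ^ 3 = 1 :=
  PresentedGroup.one_of_mem (Or.inl (Or.inl ⟨3, rfl, rfl⟩))

theorem of_one_pow_three : (PresentedGroup.of 1 : Lambda2 3 3 n) ^ 3 = 1 :=
  PresentedGroup.one_of_mem (Or.inl (Or.inr ⟨3, rfl, rfl⟩))

theorem of_zero_mul_of_one_pow (k : ℕ) :
    ((PresentedGroup.of 0 : Lambda2 3 3 k) * PresentedGroup.of 1) ^ k = 1 :=
  PresentedGroup.one_of_mem (Or.inr ⟨k, rfl, rfl⟩)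

theorem mem_of_generators {G : Type*} [Group G] (ψ : Lambda2 3 3 n →* G)
    (hψ : Function.Surjective ψ) (H : Subgroup G) (h0 : ψ (PresentedGroup.of 0) ∈ H)
    (h1 : ψ (PresentedGroup.of 1) ∈ H) (g : G) : g ∈ H :=
  mem_of_freeGroup_surjective (ψ.comp (PresentedGroup.mk _))
    (hψ.comp (PresentedGroup.mk_surjective _)) H h0 h1 g

/-- The morphism from `Λ₂(3,3,n)` given by two elements that satisfy the relations. -/
def lift {G : Type*} [Group G] (x y : G) (hx : x ^ 3 = 1) (hy : y ^ 3 = 1)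
    (hxy : ∀ k : ℕ, n = k → (x * y) ^ k = 1) : Lambda2 3 3 n →* G :=
  PresentedGroup.toGroup (f := ![x, y]) (by
    rintro r ((⟨k, hk, rfl⟩ | ⟨k, hk, rfl⟩) | ⟨k, hk, rfl⟩)
    · obtain rfl : 3 = k := by exact_mod_cast hk
      simpa using hx
    · obtain rfl : 3 = k := by exact_mod_cast hk
      simpa using hy
    · simpa using hxy k hk)

theorem lift_of_zero {G : Type*} [Group G] (x y : G) (hx : x ^ 3 = 1) (hy : y ^ 3 = 1)
    (hxy : ∀ k : ℕ, n = k → (x * y) ^ k = 1) : lift x y hx hy hxy (PresentedGroup.of 0) = x :=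
  PresentedGroup.toGroup.of _

theorem lift_of_one {G : Type*} [Group G] (x y : G) (hx : x ^ 3 = 1) (hy : y ^ 3 = 1)
    (hxy : ∀ k : ℕ, n = k → (x * y) ^ k = 1) : lift x y hx hy hxy (PresentedGroup.of 1) = y :=
  PresentedGroup.toGroup.of _

/-- The morphism `Λ₂(3,3,n) → ℤ/3`, `x ↦ 1`, `y ↦ -1`. -/
def toZMod (n : ℕ∞) : Lambda2 3 3 n →* Multiplicative (ZMod 3) :=
  lift (Multiplicative.ofAdd 1) (Multiplicative.ofAdd 2) (by decide) (by decide) (fun k _ => by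
    -- With `y ↦ 2 = -1` the product `xy` is killed, so the third relation holds whatever `n` is.
    rw [show (Multiplicative.ofAdd 1 * Multiplicative.ofAdd 2 : Multiplicative (ZMod 3)) = 1 by
      decide, one_pow])

theorem toZMod_of_zero : toZMod n (PresentedGroup.of 0) = Multiplicative.ofAdd 1 :=
  lift_of_zero ..

theorem toZMod_ne_one : toZMod n (PresentedGroup.of 0) ≠ 1 := by
  rw [toZMod_of_zero]
  decide

/-- In an abelian quotient `(xy)³ = x³y³ = 1`; together with `(xy)^k = 1` and `k` prime to `3` this
forces `y = x⁻¹`. -/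
theorem abelianization_of_not_dvd (k : ℕ) (hk : ¬ 3 ∣ k) :
    Nonempty (Abelianization (Lambda2 3 3 (k : ℕ∞)) ≃* Multiplicative (ZMod 3)) := by
  have h0 := congrArg Abelianization.of (of_zero_pow_three (n := k))
  have h1 := congrArg Abelianization.of (of_one_pow_three (n := k))
  have h2 := congrArg Abelianization.of (of_zero_mul_of_one_pow k)
  simp only [map_pow, map_mul, map_one] at h0 h1 h2
  set x := Abelianization.of (PresentedGroup.of 0 : Lambda2 3 3 k) with hx
  set y := Abelianization.of (PresentedGroup.of 1 : Lambda2 3 3 k) with hy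
  have h3 : (x * y) ^ 3 = 1 := by rw [mul_pow, h0, h1, one_mul]
  have hxy : x * y = 1 := by
    have hc : Nat.gcd k 3 = 1 := ((Nat.Prime.coprime_iff_not_dvd Nat.prime_three).mpr hk).symm
    have := pow_gcd_eq_one.mpr ⟨h2, h3⟩
    rwa [hc, pow_one] at this
  refine nonempty_mulEquiv_zmod (Abelianization.lift (toZMod k)) x h0
    (by rw [hx, Abelianization.lift_apply_of, toZMod_of_zero]) ?_
  refine mem_of_generators Abelianization.of QuotientGroup.mk_surjective _
    (Subgroup.mem_zpowers x) ?_
  rw [← hy, eq_inv_of_mul_eq_one_right hxy]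
  exact Subgroup.inv_mem _ (Subgroup.mem_zpowers x)

/-- When `3 ∣ n` the third relation follows from the first two after abelianizing. The hypothesis is
phrased so that it is vacuous for `n = ∞`, which treats both cases at once. -/
theorem abelianization_of_forall_dvd (hn : ∀ k : ℕ, n = k → 3 ∣ k) :
    Nonempty (Abelianization (Lambda2 3 3 n) ≃* Multiplicative (ZMod 3 × ZMod 3)) := by
  have h0 := congrArg Abelianization.of (of_zero_pow_three (n := n))
  have h1 := congrArg Abelianization.of (of_one_pow_three (n := n))
  simp only [map_pow, map_one] at h0 h1
  refine nonempty_mulEquiv_zmod_prod (Abelianization.lift (lift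
      (Multiplicative.ofAdd (1, 0)) (Multiplicative.ofAdd (0, 1)) (by decide) (by decide) ?_))
    _ _ h0 h1 ?_ ?_ ?_
  · intro k hk
    obtain ⟨l, rfl⟩ := hn k hk
    rw [pow_mul, show (Multiplicative.ofAdd (1, 0) * Multiplicative.ofAdd (0, 1) :
      Multiplicative (ZMod 3 × ZMod 3)) ^ 3 = 1 by decide, one_pow]
  · rw [Abelianization.lift_apply_of, lift_of_zero]
  · rw [Abelianization.lift_apply_of, lift_of_one]
  · exact mem_of_generators Abelianization.of QuotientGroup.mk_surjective _
      (Subgroup.subset_closure (by simp)) (Subgroup.subset_closure (by simp))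

/-- A group of exponent prime to `3` up to commutators does not map onto `Λ₂(3,3,n)`. -/
theorem not_surjective_of_abelianization_pow {G : Type*} [Group G] {m : ℕ} (hm : Nat.gcd m 3 = 1)
    (hG : ∀ g : Abelianization G, g ^ m = 1) (f : G →* Lambda2 3 3 n) :
    ¬ Function.Surjective f := by
  intro hf
  obtain ⟨g, hg⟩ := hf (PresentedGroup.of 0)
  apply toZMod_ne_one (n := n)
  rw [← hg]
  have h1 : toZMod n (f g) ^ m = 1 := by
    have := congrArg (Abelianization.lift ((toZMod n).comp f)) (hG (Abelianization.of g))
    simpa using this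
  have h2 : toZMod n (f g) ^ 3 = 1 := by
    rw [hg, ← map_pow, of_zero_pow_three, map_one]
  have := pow_gcd_eq_one.mpr ⟨h1, h2⟩
  rwa [hm, pow_one] at this

theorem not_surjective_abelianization {A : Type*} [CommGroup A] {m : ℕ} (hm : Nat.gcd m 3 = 1)
    (hA : ∀ g : A, g ^ m = 1) (f : A →* Abelianization (Lambda2 3 3 n)) :
    ¬ Function.Surjective f := by
  intro hf
  obtain ⟨g, hg⟩ := hf (Abelianization.of (PresentedGroup.of 0))
  apply toZMod_ne_one (n := n)
  rw [← Abelianization.lift_apply_of (toZMod n), ← hg]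
  have h1 := congrArg (Abelianization.lift (toZMod n) ∘ f) (hA g)
  simp only [Function.comp_apply, map_pow, map_one] at h1
  have h2 : Abelianization.lift (toZMod n) (f g) ^ 3 = 1 := by
    rw [hg, Abelianization.lift_apply_of, ← map_pow, of_zero_pow_three, map_one]
  have := pow_gcd_eq_one.mpr ⟨h1, h2⟩
  rwa [hm, pow_one] at this

/-- Obstruction to being the image of `Λ₂(3,3,n)`: a subgroup with a sign character that is
nontrivial is not generated by two elements of order `3`. -/
theorem range_ne_of_sign {Γ G : Type*} [Group Γ] [Group G] (ξ : Γ →* G) (ψ : Γ →* ℤˣ)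
    (hker : ∀ γ, ξ γ = 1 → ψ γ = 1) {γ₀ : Γ} (hγ₀ : ψ γ₀ = -1) (δ : Lambda2 3 3 n →* G) :
    ξ.range ≠ δ.range := by
  intro h
  -- A lift `γ` of `δ x` satisfies `ξ (γ³) = 1`, so `ψ γ` has trivial cube in `{±1}` and is `1`.
  have hgen : ∀ x : Lambda2 3 3 n, x ^ 3 = 1 → δ x ∈ ψ.ker.map ξ := fun x hx => by
    obtain ⟨γ, hγ⟩ : δ x ∈ ξ.range := h ▸ ⟨x, rfl⟩
    refine ⟨γ, ?_, hγ⟩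
    have h3 : ψ γ ^ 3 = 1 := by
      rw [← map_pow]
      exact hker _ (by rw [map_pow, hγ, ← map_pow, hx, map_one])
    rcases Int.units_eq_one_or (ψ γ) with h1 | h1
    · exact h1
    · rw [h1] at h3
      exact absurd h3 (by decide)
  have hall : ∀ x : Lambda2 3 3 n, x ∈ (ψ.ker.map ξ).comap δ :=
    mem_of_generators (MonoidHom.id _) Function.surjective_id _ (hgen _ of_zero_pow_three)
      (hgen _ of_one_pow_three)
  obtain ⟨x, hx⟩ : ξ γ₀ ∈ δ.range := h ▸ ⟨γ₀, rfl⟩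
  obtain ⟨γ, hγ1, hγ2⟩ := hall x
  have := hker (γ₀ * γ⁻¹) (by rw [map_mul, map_inv, hγ2, hx, mul_inv_cancel])
  rw [map_mul, map_inv, hγ₀, show ψ γ = 1 from hγ1] at this
  exact absurd this (by decide)

end Lambda2

/-! ## Dehn fillings -/

namespace CuspedPresentation

variable (M : CuspedPresentation) (p q : ℤ)

/-- The projection from the free group to the abelianization of the group of a Dehn filling. -/
def freeToFillingAb : FreeGroup (Fin 2) →* Abelianization (M.FillingPi1 p q) :=
  Abelianization.of.comp ((M.toFilling p q).comp (PresentedGroup.mk {M.relator}))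

theorem freeToFillingAb_surjective : Function.Surjective (M.freeToFillingAb p q) :=
  QuotientGroup.mk_surjective.comp
    (QuotientGroup.mk_surjective.comp (PresentedGroup.mk_surjective _))

theorem freeToFillingAb_relator : M.freeToFillingAb p q M.relator = 1 := by
  rw [freeToFillingAb, MonoidHom.comp_apply, MonoidHom.comp_apply,
    PresentedGroup.one_of_mem (Set.mem_singleton _), map_one, map_one]

theorem freeToFillingAb_slope :
    M.freeToFillingAb p q (M.meridian ^ p * M.longitude ^ q) = 1 := by
  have h : M.toFilling p q (M.mer ^ p * M.lon ^ q) = 1 :=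
    (QuotientGroup.eq_one_iff _).mpr (Subgroup.subset_normalClosure (Set.mem_singleton _))
  rw [freeToFillingAb, MonoidHom.comp_apply, MonoidHom.comp_apply, map_mul, map_zpow, map_zpow]
  exact (congrArg Abelianization.of h).trans (map_one _)

variable {M p q}

/-- The morphism from the group of a Dehn filling induced by a morphism that kills the slope. -/
def fillingLift {G : Type*} [Group G] (ξ : M.Pi1 →* G) (h : ξ M.mer ^ p * ξ M.lon ^ q = 1) :
    M.FillingPi1 p q →* G :=
  QuotientGroup.lift _ ξ (Subgroup.normalClosure_le_normal (N := ξ.ker) (by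
    rw [Set.singleton_subset_iff]
    simpa [MonoidHom.mem_ker] using h))

theorem factorsThroughFilling {ξ : M.Pi1 →* PU21} (h : ξ M.mer ^ p * ξ M.lon ^ q = 1) :
    FactorsThroughFilling ξ p q :=
  ⟨fillingLift ξ h, MonoidHom.ext fun _ => rfl⟩

/-- Here `α` and `β` are the intended classes of `a` and `b` in `ℤ/m`, and `i` selects the generator
that has class `1`. -/
theorem nonempty_abelianization_filling_mulEquiv {m : ℕ} (α β : ZMod m)
    (hrel : FreeGroup.lift ![Multiplicative.ofAdd α, Multiplicative.ofAdd β] M.relator = 1)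
    (hslope : FreeGroup.lift ![Multiplicative.ofAdd α, Multiplicative.ofAdd β] M.meridian ^ p *
      FreeGroup.lift ![Multiplicative.ofAdd α, Multiplicative.ofAdd β] M.longitude ^ q = 1)
    (i : Fin 2) (hi : ![Multiplicative.ofAdd α, Multiplicative.ofAdd β] i = Multiplicative.ofAdd 1)
    (hpow : M.freeToFillingAb p q (FreeGroup.of i) ^ m = 1)
    (h0 : M.freeToFillingAb p q (FreeGroup.of 0) ∈
      Subgroup.zpowers (M.freeToFillingAb p q (FreeGroup.of i)))
    (h1 : M.freeToFillingAb p q (FreeGroup.of 1) ∈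
      Subgroup.zpowers (M.freeToFillingAb p q (FreeGroup.of i))) :
    Nonempty (Abelianization (M.FillingPi1 p q) ≃* Multiplicative (ZMod m)) :=
  nonempty_mulEquiv_zmod
    (Abelianization.lift (fillingLift (M := M) (PresentedGroup.toGroup
      (fun r hr => by rw [Set.mem_singleton_iff.mp hr]; exact hrel)) hslope)) _ hpow
    ((FreeGroup.lift_apply_of (f := ![Multiplicative.ofAdd α, Multiplicative.ofAdd β])).trans hi)
    (mem_of_freeGroup_surjective _ (M.freeToFillingAb_surjective p q) _ h0 h1)

/-- No quotient of a Dehn filling is `Λ₂(3,3,n)` when its homology has order prime to `3`. -/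
theorem not_surjective_of_mulEquiv {m : ℕ} (hm : Nat.gcd m 3 = 1)
    (e : Nonempty (Abelianization (M.FillingPi1 p q) ≃* Multiplicative (ZMod m))) (n : ℕ∞) :
    (∀ f : Abelianization (M.FillingPi1 p q) →* Abelianization (Lambda2 3 3 n),
      ¬ Function.Surjective f) ∧
    (∀ f : M.FillingPi1 p q →* Lambda2 3 3 n, ¬ Function.Surjective f) := by
  obtain ⟨e⟩ := e
  have hpow : ∀ g : Abelianization (M.FillingPi1 p q), g ^ m = 1 := fun g => e.injective (by
    rw [map_pow, map_one]
    apply Multiplicative.toAdd.injective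
    rw [toAdd_pow, toAdd_one, nsmul_eq_mul, CharP.cast_eq_zero, zero_mul])
  exact ⟨Lambda2.not_surjective_abelianization hm hpow,
    Lambda2.not_surjective_of_abelianization_pow hm hpow⟩

/-- Composing with a surjective `ρ` does not change the image of `δ`. -/
theorem not_arisesFromLambda2 {ξ : M.Pi1 →* PU21} {n : ℕ∞}
    (h : ∀ δ : Lambda2 3 3 n →* PU21, ξ.range ≠ δ.range) : ¬ ArisesFromLambda2 ξ n := by
  rintro ⟨ρ, δ, hρ, rfl⟩
  refine h δ ?_
  rw [MonoidHom.range_comp, MonoidHom.range_eq_top.mpr hρ, MonoidHom.range_eq_map]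

theorem map_peripheral {ξ : M.Pi1 →* PU21} (k : ℤ)
    (hk : ξ M.lon = ξ M.mer ^ k) :
    M.peripheral.map ξ = Subgroup.zpowers (ξ M.mer) := by
  rw [peripheral, MonoidHom.map_closure, Set.image_pair, hk]
  refine le_antisymm ((Subgroup.closure_le _).mpr ?_) ?_
  · rintro _ (rfl | rfl)
    · exact Subgroup.mem_zpowers _
    · exact Subgroup.zpow_mem_zpowers _ _
  · rw [Subgroup.zpowers_le]
    exact Subgroup.subset_closure (Or.inl rfl)

end CuspedPresentation

/-! ### Homology of the three fillings -/

open CuspedPresentation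

/-- Abelianized, the relator reads `2a = 0` and the slope `-11a - 7b = 0`, with determinant `-14`;
hence `a = 7b` and `14b = 0`. -/
theorem generators_of_filling_m045 {C : Type} [CommGroup C] (θ : FreeGroup (Fin 2) →* C)
    (h1 : θ m045.relator = 1)
    (h2 : θ (m045.meridian ^ (5 : ℤ) * m045.longitude ^ (1 : ℤ)) = 1) :
    θ (FreeGroup.of 1) ^ 14 = 1 ∧ θ (FreeGroup.of 1) ^ 7 = θ (FreeGroup.of 0) := by
  simp only [m045, map_mul, map_pow, map_inv, map_zpow] at h1 h2
  -- The relations are transported to additive notation so that `module` can check the integer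
  -- combinations.
  have key : ∀ {B : Type} [AddCommGroup B] (a b : B),
      3 • a + 2 • b + 3 • a + -b + 4 • -a + -b = 0 →
      (5 : ℤ) • (-a + -b) + (1 : ℤ) • (b + 3 • -a + 3 • -b + 3 • -a) = 0 →
      14 • b = 0 ∧ 7 • b = a := fun a b h1 h2 =>
    ⟨by linear_combination (norm := module) -(11 : ℤ) • h1 - (2 : ℤ) • h2,
     by linear_combination (norm := module) -(6 : ℤ) • h1 - (1 : ℤ) • h2⟩
  exact key (B := Additive C) _ _ h1 h2

theorem abelianization_filling_m045 :
    Nonempty (Abelianization (m045.FillingPi1 5 1) ≃* Multiplicative (ZMod 14)) := by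
  obtain ⟨h3, h4⟩ := generators_of_filling_m045 _ (m045.freeToFillingAb_relator 5 1)
    (m045.freeToFillingAb_slope 5 1)
  exact nonempty_abelianization_filling_mulEquiv 7 1 (by decide) (by decide) 1 rfl h3
    ⟨(7 : ℕ), (zpow_natCast _ _).trans h4⟩ (Subgroup.mem_zpowers _)

/-- The relator reads `4b = 0` and the slope `5a - 3b = 0`; hence `b = 15a` and `20a = 0`. -/
theorem generators_of_filling_m035 {C : Type} [CommGroup C] (θ : FreeGroup (Fin 2) →* C)
    (h1 : θ m035.relator = 1)
    (h2 : θ (m035.meridian ^ (3 : ℤ) * m035.longitude ^ ((-1) : ℤ)) = 1) :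
    θ (FreeGroup.of 0) ^ 20 = 1 ∧ θ (FreeGroup.of 0) ^ 15 = θ (FreeGroup.of 1) := by
  simp only [m035, map_mul, map_pow, map_inv, map_zpow] at h1 h2
  have key : ∀ {B : Type} [AddCommGroup B] (a b : B),
      a + 3 • b + 2 • -a + 3 • b + a + 2 • -b = 0 →
      (3 : ℤ) • (a + b) + (-1 : ℤ) • (a + 3 • b + 3 • -a + 3 • b) = 0 →
      20 • a = 0 ∧ 15 • a = b := fun a b h1 h2 =>
    ⟨by linear_combination (norm := module) (3 : ℤ) • h1 + (4 : ℤ) • h2,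
     by linear_combination (norm := module) (2 : ℤ) • h1 + (3 : ℤ) • h2⟩
  exact key (B := Additive C) _ _ h1 h2

theorem abelianization_filling_m035 :
    Nonempty (Abelianization (m035.FillingPi1 3 (-1)) ≃* Multiplicative (ZMod 20)) := by
  obtain ⟨h3, h4⟩ := generators_of_filling_m035 _ (m035.freeToFillingAb_relator 3 (-1))
    (m035.freeToFillingAb_slope 3 (-1))
  exact nonempty_abelianization_filling_mulEquiv 1 15 (by decide) (by decide) 0 rfl h3
    (Subgroup.mem_zpowers _) ⟨(15 : ℕ), (zpow_natCast _ _).trans h4⟩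

/-- The relator reads `8b - 8a = 0` and the slope `7b - 5a = 0`; their difference gives `b = 3a`,
and then `16a = 0`. -/
theorem generators_of_filling_m130 {C : Type} [CommGroup C] (θ : FreeGroup (Fin 2) →* C)
    (h1 : θ m130.relator = 1)
    (h2 : θ (m130.meridian ^ (2 : ℤ) * m130.longitude ^ ((-1) : ℤ)) = 1) :
    θ (FreeGroup.of 0) ^ 16 = 1 ∧ θ (FreeGroup.of 0) ^ 3 = θ (FreeGroup.of 1) := by
  simp only [m130, map_mul, map_pow, map_inv, map_zpow] at h1 h2
  have key : ∀ {B : Type} [AddCommGroup B] (a b : B),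
      2 • b + -a + b + -a + 2 • b + -a + b + -a + 2 • b + 4 • -a = 0 →
      (2 : ℤ) • (b + -a + 2 • b) + (-1 : ℤ) • (-b + 3 • a) = 0 →
      16 • a = 0 ∧ 3 • a = b := fun a b h1 h2 =>
    ⟨by linear_combination (norm := module) (8 : ℤ) • h2 - (7 : ℤ) • h1,
     by linear_combination (norm := module) (1 : ℤ) • h2 - (1 : ℤ) • h1⟩
  exact key (B := Additive C) _ _ h1 h2

theorem abelianization_filling_m130 :
    Nonempty (Abelianization (m130.FillingPi1 2 (-1)) ≃* Multiplicative (ZMod 16)) := by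
  obtain ⟨h3, h4⟩ := generators_of_filling_m130 _ (m130.freeToFillingAb_relator 2 (-1))
    (m130.freeToFillingAb_slope 2 (-1))
  exact nonempty_abelianization_filling_mulEquiv 1 3 (by decide) (by decide) 0 rfl h3
    (Subgroup.mem_zpowers _) ⟨(3 : ℕ), (zpow_natCast _ _).trans h4⟩

open Matrix

/-! ## Scalar matrices and unipotent elements -/

theorem exists_scalar_of_mk_eq_one {u : U21} (hu : (QuotientGroup.mk u : PU21) = 1) :
    ∃ c : ℂ, Matrix.scalar (Fin 3) c = ((u : GL (Fin 3) ℂ) : Matrix (Fin 3) (Fin 3) ℂ) :=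
  GeneralLinearGroup.mem_center_iff_val_mem_range_scalar.mp
    (Subgroup.mem_subgroupOf.mp ((QuotientGroup.eq_one_iff u).mp hu))

theorem toC_injective {d : ℤ} {w : ℂ} (hw : w * w = (d : ℂ)) (hd : d < 0) :
    Function.Injective (toC d w hw) :=
  Zsqrtd.lift_injective _ fun n h => absurd (mul_self_nonneg n) (by omega)

/-- A matrix over `ℤ[√d]` proportional to a scalar matrix is a scalar matrix. -/
theorem eq_scalar_of_smul_eq_scalar {d : ℤ} {w : ℂ} (hw : w * w = (d : ℂ)) (hd : d < 0)
    {A : Matrix (Fin 3) (Fin 3) (ℤ√d)} {s c : ℂ} (hs : s ≠ 0)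
    (h : Matrix.scalar (Fin 3) c = s • (toC d w hw).mapMatrix A) :
    A = Matrix.scalar (Fin 3) (A 0 0) := by
  have hij : ∀ i j, Matrix.scalar (Fin 3) c i j = s * toC d w hw (A i j) := fun i j => by
    rw [h]
    rfl
  ext1 i j
  apply toC_injective hw hd
  apply mul_left_cancel₀ hs
  rw [← hij]
  rcases eq_or_ne i j with rfl | hne
  · have := hij 0 0
    simp only [scalar_apply, diagonal_apply_eq] at this ⊢
    exact this
  · simp [hne]

/-- Evaluation of a product of matrices over `ℤ[√d]` that is a scalar integer. -/
theorem smul_mapMatrix_natCast {d : ℤ} {w : ℂ} (hw : w * w = (d : ℂ)) {N : ℕ} {s : ℂ}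
    (hs : s * N = 1) :
    s • (toC d w hw).mapMatrix (N : Matrix (Fin 3) (Fin 3) (ℤ√d)) = 1 := by
  rw [map_natCast, ← nsmul_one, ← Nat.cast_smul_eq_nsmul ℂ, smul_smul, hs, one_smul]

/-- Both conditions become decidable over `ℤ[√d]`: nilpotency of `u - 1` is that of `A - N`, and
nontriviality in `PU(2,1)` means that `A` is not scalar. -/
theorem isUnipotent_of_int {d : ℤ} {w : ℂ} (hw : w * w = (d : ℂ)) (hd : d < 0) (u : U21) (N : ℕ)
    (hN : N ≠ 0) (A : Matrix (Fin 3) (Fin 3) (ℤ√d))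
    (hu : ((u : GL (Fin 3) ℂ) : Matrix (Fin 3) (Fin 3) ℂ) =
      (1 / (N : ℂ)) • (toC d w hw).mapMatrix A)
    (hnil : (A - (N : Matrix (Fin 3) (Fin 3) (ℤ√d))) ^ 3 = 0)
    (hA : A ≠ Matrix.scalar (Fin 3) (A 0 0)) :
    IsUnipotent (QuotientGroup.mk u) := by
  have hN' : (N : ℂ) ≠ 0 := by exact_mod_cast hN
  refine ⟨fun h => ?_, u, rfl, 3, ?_⟩
  · obtain ⟨c, hc⟩ := exists_scalar_of_mk_eq_one h
    exact hA (eq_scalar_of_smul_eq_scalar hw hd (one_div_ne_zero hN') (hc.trans hu))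
  · have : ((u : GL (Fin 3) ℂ) : Matrix (Fin 3) (Fin 3) ℂ) - 1 =
        (1 / (N : ℂ)) • (toC d w hw).mapMatrix (A - (N : Matrix (Fin 3) (Fin 3) (ℤ√d))) := by
      rw [hu, map_sub, smul_sub, smul_mapMatrix_natCast hw (one_div_mul_cancel hN')]
    rw [this, smul_pow, ← map_pow, hnil, map_zero, smul_zero]

/-! ## Reduction to a ramified prime -/

/-- The class `g` in `PU(2,1)` is represented by a multiple of a matrix over `ℤ[√d]` whose reduction
along `f` permutes the lines spanned by the vectors `v i` according to `σ`. -/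
def PermutesLines {d : ℤ} {w : ℂ} (hw : w * w = (d : ℂ)) {F : Type*} [Field F] (f : ℤ√d →+* F)
    {k : ℕ} (v : Fin k → Fin 3 → F) (g : PU21) (σ : Equiv.Perm (Fin k)) : Prop :=
  ∃ (u : U21) (s : ℂ) (A : Matrix (Fin 3) (Fin 3) (ℤ√d)), QuotientGroup.mk u = g ∧ s ≠ 0 ∧
    ((u : GL (Fin 3) ℂ) : Matrix (Fin 3) (Fin 3) ℂ) = s • (toC d w hw).mapMatrix A ∧
    ∀ i, ∃ c : F, c ≠ 0 ∧ f.mapMatrix A *ᵥ v i = c • v (σ i)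

namespace PermutesLines

variable {d : ℤ} {w : ℂ} {hw : w * w = (d : ℂ)} {F : Type*} [Field F] {f : ℤ√d →+* F} {k : ℕ}
  {v : Fin k → Fin 3 → F}

theorem one : PermutesLines hw f v 1 1 :=
  ⟨1, 1, 1, rfl, one_ne_zero, by simp, fun i => ⟨1, one_ne_zero, by simp⟩⟩

theorem mul {g h : PU21} {σ τ : Equiv.Perm (Fin k)} (hg : PermutesLines hw f v g σ)
    (hh : PermutesLines hw f v h τ) : PermutesLines hw f v (g * h) (σ * τ) := by
  obtain ⟨u, s, A, rfl, hs, hu, hA⟩ := hg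
  obtain ⟨u', s', A', rfl, hs', hu', hA'⟩ := hh
  refine ⟨u * u', s * s', A * A', rfl, mul_ne_zero hs hs', ?_, fun i => ?_⟩
  · rw [Subgroup.coe_mul, Units.val_mul, hu, hu', smul_mul_smul_comm, map_mul]
  · obtain ⟨c', hc', h'⟩ := hA' i
    obtain ⟨c, hc, h⟩ := hA (τ i)
    refine ⟨c' * c, mul_ne_zero hc' hc, ?_⟩
    rw [map_mul, ← mulVec_mulVec, h', mulVec_smul, h, smul_smul, Equiv.Perm.mul_apply]

/-- An integral representative of the trivial class is a scalar matrix, so its reduction fixes every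
line; the nonzero factors in `PermutesLines` exclude reduction to zero. This makes the permutation
an invariant of the class in `PU(2,1)`, independent of the chosen representative. -/
theorem eq_one (hd : d < 0) (hv : ∀ i j (b c : F), c ≠ 0 → b • v i = c • v j → i = j)
    {σ : Equiv.Perm (Fin k)} (h : PermutesLines hw f v 1 σ) : σ = 1 := by
  obtain ⟨u, s, A, hu1, hs, hu, hA⟩ := h
  obtain ⟨c, hc⟩ := exists_scalar_of_mk_eq_one hu1
  have hscal := eq_scalar_of_smul_eq_scalar hw hd hs (hc.trans hu)
  ext1 i
  obtain ⟨c', hc', h'⟩ := hA i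
  refine (hv i (σ i) (f (A 0 0)) c' hc' ?_).symm
  rw [← h', hscal]
  ext j
  simp [mulVec_diagonal]

variable (hw f v) in
/-- The elements of `PU(2,1)`, with permutations, such that they and their inverses permute
lines. -/
def subgroup : Subgroup (PU21 × Equiv.Perm (Fin k)) where
  carrier := {x | PermutesLines hw f v x.1 x.2 ∧ PermutesLines hw f v x.1⁻¹ x.2⁻¹}
  one_mem' := ⟨one, by simpa using one⟩
  mul_mem' := fun ha hb => ⟨ha.1.mul hb.1, by
    rw [Prod.fst_mul, Prod.snd_mul, _root_.mul_inv_rev, _root_.mul_inv_rev]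
    exact hb.2.mul ha.2⟩
  inv_mem' := fun ha => ⟨ha.2, by simpa using ha.1⟩

theorem mem_subgroup_of_int (hs : star w = -w) {A : Matrix (Fin 3) (Fin 3) (ℤ√d)} {N : ℕ}
    (hN : N ≠ 0) {U : Matrix (Fin 3) (Fin 3) ℂ} (hU : Uᴴ * J21 * U = J21)
    (hUA : U = (1 / (N : ℂ)) • (toC d w hw).mapMatrix A) (σ : Equiv.Perm (Fin k))
    (h1 : ∀ i, ∃ c : F, c ≠ 0 ∧ f.mapMatrix A *ᵥ v i = c • v (σ i))
    (h2 : ∀ i, ∃ c : F, c ≠ 0 ∧ f.mapMatrix (JZ d * Aᴴ * JZ d) *ᵥ v i = c • v (σ⁻¹ i)) :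
    ((QuotientGroup.mk (mkU21 U hU) : PU21), σ) ∈ subgroup hw f v := by
  have hN' : (1 / (N : ℂ)) ≠ 0 := one_div_ne_zero (by exact_mod_cast hN)
  refine ⟨⟨mkU21 U hU, _, A, rfl, hN', hUA, h1⟩,
    ⟨(mkU21 U hU)⁻¹, _, JZ d * Aᴴ * JZ d, rfl, hN', ?_, h2⟩⟩
  rw [← inv_of_int d w hw hs, ← hUA]
  rfl

end PermutesLines

namespace CuspedPresentation

variable {M : CuspedPresentation}

/-- If the reduction of `ξ` permutes lines, `a` and `b` acting by odd permutations, then the image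
of `ξ` is not the image of a representation of `Λ₂(3,3,n)`. -/
theorem range_ne_of_permutesLines {d : ℤ} {w : ℂ} {hw : w * w = (d : ℂ)} (hd : d < 0) {F : Type*}
    [Field F] {f : ℤ√d →+* F} {k : ℕ} {v : Fin k → Fin 3 → F}
    (hv : ∀ i j (b c : F), c ≠ 0 → b • v i = c • v j → i = j) (ξ : M.Pi1 →* PU21)
    (σ : Fin 2 → Equiv.Perm (Fin k)) (hσ : ∀ i, Equiv.Perm.sign (σ i) = -1)
    (hξ : ∀ i, (ξ (PresentedGroup.of i), σ i) ∈ PermutesLines.subgroup hw f v)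
    (hrel : FreeGroup.lift (fun _ : Fin 2 => (-1 : ℤˣ)) M.relator = 1) (n : ℕ∞)
    (δ : Lambda2 3 3 n →* PU21) : ξ.range ≠ δ.range := by
  -- The parity of word length, well defined because the relator has even length.
  let ψ : M.Pi1 →* ℤˣ := PresentedGroup.toGroup (f := fun _ => -1)
    (fun r hr => by rw [Set.mem_singleton_iff.mp hr]; exact hrel)
  have hψ : ∀ i, ψ (PresentedGroup.of i) = -1 := fun i => PresentedGroup.toGroup.of _
  -- The pairs (class, sign of a permutation it induces). The graph of `(ξ, ψ)` lies in `H` since it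
  -- does on generators, so `ξ γ = 1` forces `ψ γ` to be the sign of the identity.
  let H : Subgroup (PU21 × ℤˣ) := (PermutesLines.subgroup hw f v).map
    ((MonoidHom.id PU21).prodMap Equiv.Perm.sign)
  have hH : ∀ x : PU21 × ℤˣ, x ∈ (ξ.prod ψ).range → x ∈ H := by
    rintro _ ⟨γ, rfl⟩
    have hgen : ∀ i, PresentedGroup.of i ∈ H.comap (ξ.prod ψ) := fun i =>
      ⟨(ξ (PresentedGroup.of i), σ i), hξ i, Prod.ext rfl ((hσ i).trans (hψ i).symm)⟩
    exact mem_of_freeGroup_surjective (PresentedGroup.mk _) (PresentedGroup.mk_surjective _)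
      (H.comap (ξ.prod ψ)) (hgen 0) (hgen 1) γ
  refine Lambda2.range_ne_of_sign ξ ψ (fun γ hγ => ?_) (hψ 0) δ
  obtain ⟨⟨g, τ⟩, hmem, hx⟩ := hH _ ⟨γ, rfl⟩
  have hg : g = 1 := (congrArg Prod.fst hx).trans hγ
  have hτ : Equiv.Perm.sign τ = ψ γ := congrArg Prod.snd hx
  subst hg
  rw [← hτ, show τ = 1 from hmem.1.eq_one hd hv, map_one]

end CuspedPresentation

/-! ### Sign characters of the three images, from conics over `𝔽₇` and `𝔽₅` -/

instance fact_prime_seven : Fact (Nat.Prime 7) := ⟨by norm_num⟩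

instance fact_prime_five : Fact (Nat.Prime 5) := ⟨by norm_num⟩

/-- The reduction `ℤ[√-7] → 𝔽₇`, `√-7 ↦ 0`. -/
def reduction7 : ℤ√(-7) →+* ZMod 7 := Zsqrtd.lift ⟨0, by decide⟩

/-- The reduction `ℤ[√-15] → 𝔽₅`, `√-15 ↦ 0`. -/
def reduction5 : ℤ√(-15) →+* ZMod 5 := Zsqrtd.lift ⟨0, by decide⟩

/-- The points of the conic `x² + y² = z²` over `𝔽₇`. -/
def conic7 : Fin 8 → Fin 3 → ZMod 7 :=
  ![![0, 1, 1], ![0, 1, 6], ![1, 0, 1], ![1, 0, 6], ![1, 1, 3], ![1, 1, 4], ![1, 6, 3], ![1, 6, 4]]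

/-- The points of the conic `x² + y² = z²` over `𝔽₅`. -/
def conic5 : Fin 6 → Fin 3 → ZMod 5 :=
  ![![0, 1, 1], ![0, 1, 4], ![1, 0, 1], ![1, 0, 4], ![1, 2, 0], ![1, 3, 0]]

theorem conic7_independent : ∀ i j (b c : ZMod 7), c ≠ 0 → b • conic7 i = c • conic7 j → i = j := by
  decide +kernel

theorem conic5_independent : ∀ i j (b c : ZMod 5), c ≠ 0 → b • conic5 i = c • conic5 j → i = j := by
  decide +kernel

/-- The permutations of the points of the conic over `𝔽₇` induced by the images of the
generators under m045-1. -/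
def perm045 : Fin 2 → Equiv.Perm (Fin 8) :=
  ![⟨![5, 0, 3, 4, 1, 2, 6, 7], ![1, 4, 5, 2, 3, 0, 6, 7], by decide, by decide⟩,
    ⟨![4, 7, 6, 2, 5, 1, 0, 3], ![6, 5, 3, 7, 0, 4, 2, 1], by decide, by decide⟩]

/-- The permutations of the points of the conic over `𝔽₅` induced by the images of the
generators under m035-1. -/
def perm035 : Fin 2 → Equiv.Perm (Fin 6) :=
  ![⟨![2, 5, 4, 0, 1, 3], ![3, 4, 0, 5, 2, 1], by decide, by decide⟩,
    ⟨![2, 0, 3, 5, 1, 4], ![1, 4, 0, 2, 5, 3], by decide, by decide⟩]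

/-- The permutations of the points of the conic over `𝔽₅` induced by the images of the
generators under m130-1. -/
def perm130 : Fin 2 → Equiv.Perm (Fin 6) :=
  ![⟨![2, 5, 4, 0, 1, 3], ![3, 4, 0, 5, 2, 1], by decide, by decide⟩,
    ⟨![0, 3, 2, 4, 5, 1], ![0, 5, 2, 1, 3, 4], by decide, by decide⟩]

/-- On the eight points of the conic, `a` acts as a `6`-cycle and `b` as an `8`-cycle. -/
theorem range_rep045_ne (n : ℕ∞) (δ : Lambda2 3 3 n →* PU21) : rep045.range ≠ δ.range := by
  refine CuspedPresentation.range_ne_of_permutesLines (hw := w7_mul_self) (f := reduction7)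
    (by norm_num) conic7_independent rep045 perm045 (by decide +kernel) (fun i => ?_) (by decide) n δ
  rw [rep045, PresentedGroup.toGroup.of]
  fin_cases i
  · exact PermutesLines.mem_subgroup_of_int star_w7 (N := 4) (by norm_num) _ matA045_eq _
      (by decide +kernel) (by decide +kernel)
  · exact PermutesLines.mem_subgroup_of_int star_w7 (N := 2) (by norm_num) _ matB045_eq _
      (by decide +kernel) (by decide +kernel)

/-- Both generators act as `6`-cycles on the six points of the conic. -/
theorem range_rep035_ne (n : ℕ∞) (δ : Lambda2 3 3 n →* PU21) : rep035.range ≠ δ.range := by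
  refine CuspedPresentation.range_ne_of_permutesLines (hw := w15_mul_self) (f := reduction5)
    (by norm_num) conic5_independent rep035 perm035 (by decide +kernel) (fun i => ?_) (by decide) n δ
  rw [rep035, PresentedGroup.toGroup.of]
  fin_cases i
  · exact PermutesLines.mem_subgroup_of_int star_w15 (N := 6) (by norm_num) _ matA035_eq _
      (by decide +kernel) (by decide +kernel)
  · exact PermutesLines.mem_subgroup_of_int star_w15 (N := 6) (by norm_num) _ matB035_eq _
      (by decide +kernel) (by decide +kernel)

/-- Here `a` acts as a `6`-cycle and `b` as a `4`-cycle. -/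
theorem range_rep130_ne (n : ℕ∞) (δ : Lambda2 3 3 n →* PU21) : rep130.range ≠ δ.range := by
  refine CuspedPresentation.range_ne_of_permutesLines (hw := w15_mul_self) (f := reduction5)
    (by norm_num) conic5_independent rep130 perm130 (by decide +kernel) (fun i => ?_) (by decide) n δ
  rw [rep130, PresentedGroup.toGroup.of]
  fin_cases i
  -- The matrices of `a` for m130-1 and m035-1 coincide.
  · exact PermutesLines.mem_subgroup_of_int star_w15 (N := 6) (by norm_num) _ matA035_eq _
      (by decide +kernel) (by decide +kernel)
  · exact PermutesLines.mem_subgroup_of_int star_w15 (N := 6) (by norm_num) _ matB130_eq _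
      (by decide +kernel) (by decide +kernel)

/-! ## The peripheral holonomies -/

theorem apply_mk_eq_mk_lift {M : CuspedPresentation} (ξ : M.Pi1 →* PU21) (g : Fin 2 → U21)
    (h : ∀ i, ξ (PresentedGroup.of i) = QuotientGroup.mk (g i)) (x : FreeGroup (Fin 2)) :
    ξ (PresentedGroup.mk {M.relator} x) = QuotientGroup.mk (FreeGroup.lift g x) := by
  have : ξ.comp (PresentedGroup.mk {M.relator}) =
      (QuotientGroup.mk' ((Subgroup.center (GL (Fin 3) ℂ)).subgroupOf U21)).comp
        (FreeGroup.lift g) := by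
    ext i
    rw [MonoidHom.comp_apply, MonoidHom.comp_apply, FreeGroup.lift_apply_of]
    exact h i
  exact DFunLike.congr_fun this x

theorem rep045_mer : rep045 m045.mer =
    QuotientGroup.mk (genA045⁻¹ * genB045⁻¹) := by
  rw [CuspedPresentation.mer, apply_mk_eq_mk_lift rep045 ![genA045, genB045]
    (fun i => by rw [rep045, PresentedGroup.toGroup.of]; fin_cases i <;> rfl)]
  simp only [m045, map_mul, map_inv, FreeGroup.lift_apply_of]
  rfl

theorem rep045_lon : rep045 m045.lon =
    QuotientGroup.mk (genB045 * genA045⁻¹ ^ 3 * genB045⁻¹ ^ 3 * genA045⁻¹ ^ 3) := by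
  rw [CuspedPresentation.lon, apply_mk_eq_mk_lift rep045 ![genA045, genB045]
    (fun i => by rw [rep045, PresentedGroup.toGroup.of]; fin_cases i <;> rfl)]
  simp only [m045, map_mul, map_pow, map_inv, FreeGroup.lift_apply_of]
  rfl

theorem rep035_mer : rep035 m035.mer =
    QuotientGroup.mk (genA035 * genB035) := by
  rw [CuspedPresentation.mer, apply_mk_eq_mk_lift rep035 ![genA035, genB035]
    (fun i => by rw [rep035, PresentedGroup.toGroup.of]; fin_cases i <;> rfl)]
  simp only [m035, map_mul, FreeGroup.lift_apply_of]
  rfl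

theorem rep035_lon : rep035 m035.lon =
    QuotientGroup.mk (genA035 * genB035 ^ 3 * genA035⁻¹ ^ 3 * genB035 ^ 3) := by
  rw [CuspedPresentation.lon, apply_mk_eq_mk_lift rep035 ![genA035, genB035]
    (fun i => by rw [rep035, PresentedGroup.toGroup.of]; fin_cases i <;> rfl)]
  simp only [m035, map_mul, map_pow, map_inv, FreeGroup.lift_apply_of]
  rfl

theorem rep130_mer : rep130 m130.mer =
    QuotientGroup.mk (genB130 * genA130⁻¹ * genB130 ^ 2) := by
  rw [CuspedPresentation.mer, apply_mk_eq_mk_lift rep130 ![genA130, genB130]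
    (fun i => by rw [rep130, PresentedGroup.toGroup.of]; fin_cases i <;> rfl)]
  simp only [m130, map_mul, map_pow, map_inv, FreeGroup.lift_apply_of]
  rfl

theorem rep130_lon : rep130 m130.lon =
    QuotientGroup.mk (genB130⁻¹ * genA130 ^ 3) := by
  rw [CuspedPresentation.lon, apply_mk_eq_mk_lift rep130 ![genA130, genB130]
    (fun i => by rw [rep130, PresentedGroup.toGroup.of]; fin_cases i <;> rfl)]
  simp only [m130, map_mul, map_pow, map_inv, FreeGroup.lift_apply_of]
  rfl

/-! ### Unipotent meridians and slope relations -/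

theorem isUnipotent_meridian_m045 : IsUnipotent (rep045 m045.mer) := by
  rw [rep045_mer]
  -- The denominator is `4 · 2`, one factor for each letter of the meridian.
  refine isUnipotent_of_int w7_mul_self (by norm_num) (genA045⁻¹ * genB045⁻¹) 8 (by norm_num)
    ((JZ (-7) * intA045ᴴ * JZ (-7)) * (JZ (-7) * intB045ᴴ * JZ (-7))) ?_ (by decide +kernel)
    (by decide +kernel)
  change (J21 * matA045ᴴ * J21) * (J21 * matB045ᴴ * J21) = _
  rw [matA045_eq, matB045_eq, inv_of_int _ _ _ star_w7, inv_of_int _ _ _ star_w7,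
    smul_mul_smul_comm, ← map_mul]
  norm_num

/-- The relation holds already in `U(2,1)` for the chosen matrices. Clearing denominators turns it
into an identity with a scalar integer matrix, one factor `4` or `2` per letter of the slope word.
-/
theorem meridian_pow_mul_longitude_m045 :
    (genA045⁻¹ * genB045⁻¹) ^ 5 *
      (genB045 * genA045⁻¹ ^ 3 * genB045⁻¹ ^ 3 * genA045⁻¹ ^ 3) = 1 := by
  apply Subtype.ext
  apply Units.ext
  change ((J21 * matA045ᴴ * J21) * (J21 * matB045ᴴ * J21)) ^ 5 * (matB045 *
    (J21 * matA045ᴴ * J21) ^ 3 * (J21 * matB045ᴴ * J21) ^ 3 * (J21 * matA045ᴴ * J21) ^ 3) = 1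
  rw [matA045_eq, matB045_eq, inv_of_int _ _ _ star_w7, inv_of_int _ _ _ star_w7]
  simp only [smul_pow, smul_mul_smul_comm, ← map_pow, ← map_mul]
  have h : ((JZ (-7) * intA045ᴴ * JZ (-7)) * (JZ (-7) * intB045ᴴ * JZ (-7))) ^ 5 * (intB045 *
      (JZ (-7) * intA045ᴴ * JZ (-7)) ^ 3 * (JZ (-7) * intB045ᴴ * JZ (-7)) ^ 3 *
      (JZ (-7) * intA045ᴴ * JZ (-7)) ^ 3) =
      ((4 ^ 11 * 2 ^ 9 : ℕ) : Matrix (Fin 3) (Fin 3) (ℤ√(-7))) := by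
    decide +kernel
  rw [h, smul_mapMatrix_natCast]
  norm_num

theorem isUnipotent_meridian_m035 : IsUnipotent (rep035 m035.mer) := by
  rw [rep035_mer]
  refine isUnipotent_of_int w15_mul_self (by norm_num) (genA035 * genB035) 36 (by norm_num)
    (intA035 * intB035) ?_ (by decide +kernel) (by decide +kernel)
  change matA035 * matB035 = _
  rw [matA035_eq, matB035_eq, smul_mul_smul_comm, ← map_mul]
  norm_num

theorem meridian_pow_mul_longitude_m035 :
    (genA035 * genB035) ^ 3 *
      (genA035 * genB035 ^ 3 * genA035⁻¹ ^ 3 * genB035 ^ 3)⁻¹ = 1 := by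
  -- Distributing the inverse over the letters lets each inverse be computed as `J Aᴴ J`, without
  -- leaving `ℤ[√-15]`.
  rw [show (genA035 * genB035 ^ 3 * genA035⁻¹ ^ 3 * genB035 ^ 3)⁻¹ =
    genB035⁻¹ ^ 3 * genA035 ^ 3 * genB035⁻¹ ^ 3 * genA035⁻¹ by group]
  apply Subtype.ext
  apply Units.ext
  change (matA035 * matB035) ^ 3 * ((J21 * matB035ᴴ * J21) ^ 3 * matA035 ^ 3 *
    (J21 * matB035ᴴ * J21) ^ 3 * (J21 * matA035ᴴ * J21)) = 1
  rw [matA035_eq, matB035_eq, inv_of_int _ _ _ star_w15, inv_of_int _ _ _ star_w15]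
  simp only [smul_pow, smul_mul_smul_comm, ← map_pow, ← map_mul]
  have h : (intA035 * intB035) ^ 3 * ((JZ (-15) * intB035ᴴ * JZ (-15)) ^ 3 * intA035 ^ 3 *
      (JZ (-15) * intB035ᴴ * JZ (-15)) ^ 3 * (JZ (-15) * intA035ᴴ * JZ (-15))) =
      ((6 ^ 16 : ℕ) : Matrix (Fin 3) (Fin 3) (ℤ√(-15))) := by
    decide +kernel
  rw [h, smul_mapMatrix_natCast]
  norm_num

theorem isUnipotent_meridian_m130 : IsUnipotent (rep130 m130.mer) := by
  rw [rep130_mer]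
  -- `1296 = 6⁴`, for a meridian of length four.
  refine isUnipotent_of_int w15_mul_self (by norm_num) (genB130 * genA130⁻¹ * genB130 ^ 2) 1296
    (by norm_num) (intB130 * (JZ (-15) * intA035ᴴ * JZ (-15)) * intB130 ^ 2) ?_
    (by decide +kernel) (by decide +kernel)
  change matB130 * (J21 * matA035ᴴ * J21) * matB130 ^ 2 = _
  rw [matA035_eq, matB130_eq, inv_of_int _ _ _ star_w15]
  simp only [smul_pow, smul_mul_smul_comm, ← map_pow, ← map_mul]
  norm_num

theorem meridian_pow_mul_longitude_m130 :
    (genB130 * genA130⁻¹ * genB130 ^ 2) ^ 2 * (genB130⁻¹ * genA130 ^ 3)⁻¹ = 1 := by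
  rw [show (genB130⁻¹ * genA130 ^ 3)⁻¹ = genA130⁻¹ ^ 3 * genB130 by group]
  apply Subtype.ext
  apply Units.ext
  change (matB130 * (J21 * matA035ᴴ * J21) * matB130 ^ 2) ^ 2 *
    ((J21 * matA035ᴴ * J21) ^ 3 * matB130) = 1
  rw [matA035_eq, matB130_eq, inv_of_int _ _ _ star_w15]
  simp only [smul_pow, smul_mul_smul_comm, ← map_pow, ← map_mul]
  have h : (intB130 * (JZ (-15) * intA035ᴴ * JZ (-15)) * intB130 ^ 2) ^ 2 *
      ((JZ (-15) * intA035ᴴ * JZ (-15)) ^ 3 * intB130) =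
      ((6 ^ 12 : ℕ) : Matrix (Fin 3) (Fin 3) (ℤ√(-15))) := by
    decide +kernel
  rw [h, smul_mapMatrix_natCast]
  norm_num

theorem slope_rep045 : rep045 m045.mer ^ (5 : ℤ) * rep045 m045.lon ^ (1 : ℤ) = 1 := by
  rw [rep045_mer, rep045_lon, zpow_one]
  exact congrArg (QuotientGroup.mk' ((Subgroup.center (GL (Fin 3) ℂ)).subgroupOf U21))
    meridian_pow_mul_longitude_m045

theorem slope_rep035 : rep035 m035.mer ^ (3 : ℤ) * rep035 m035.lon ^ (-1 : ℤ) = 1 := by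
  rw [rep035_mer, rep035_lon, _root_.zpow_neg_one]
  exact congrArg (QuotientGroup.mk' ((Subgroup.center (GL (Fin 3) ℂ)).subgroupOf U21))
    meridian_pow_mul_longitude_m035

theorem slope_rep130 : rep130 m130.mer ^ (2 : ℤ) * rep130 m130.lon ^ (-1 : ℤ) = 1 := by
  rw [rep130_mer, rep130_lon, _root_.zpow_neg_one]
  exact congrArg (QuotientGroup.mk' ((Subgroup.center (GL (Fin 3) ℂ)).subgroupOf U21))
    meridian_pow_mul_longitude_m130

/-! ### Assembly -/

namespace CuspedPresentation

/-- The properties of a boundary unipotent representation that factors through a Dehn filling whose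
homology is cyclic of order prime to `3`. -/
theorem rankOne_filling_properties {M : CuspedPresentation} {ξ : M.Pi1 →* PU21} {p q : ℤ} {m : ℕ}
    (hu : IsUnipotent (ξ M.mer)) (k : ℤ) (hk : ξ M.lon = ξ M.mer ^ k)
    (hslope : ξ M.mer ^ p * ξ M.lon ^ q = 1) (hm : Nat.gcd m 3 = 1)
    (hab : Nonempty (Abelianization (M.FillingPi1 p q) ≃* Multiplicative (ZMod m)))
    (hrange : ∀ (n : ℕ∞) (δ : Lambda2 3 3 n →* PU21), ξ.range ≠ δ.range) :
    IsBoundaryUnipotent ξ ∧ IsRankOneBoundaryUnipotent ξ ∧ FactorsThroughFilling ξ p q ∧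
      Nonempty (Abelianization (M.FillingPi1 p q) ≃* Multiplicative (ZMod m)) ∧
      ∀ n : ℕ∞, 4 ≤ n →
        (∀ f : Abelianization (M.FillingPi1 p q) →* Abelianization (Lambda2 3 3 n),
          ¬ Function.Surjective f) ∧
        (∀ f : M.FillingPi1 p q →* Lambda2 3 3 n, ¬ Function.Surjective f) ∧
        ¬ ArisesFromLambda2 ξ n ∧ (∀ δ : Lambda2 3 3 n →* PU21, ξ.range ≠ δ.range) := by
  have hper := map_peripheral k hk
  -- The image of the meridian serves as both unipotent generators.
  refine ⟨⟨_, _, hu, hu, Commute.refl _, ?_⟩, ⟨_, hu, hper⟩, factorsThroughFilling hslope, hab,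
    fun n _ => ⟨(not_surjective_of_mulEquiv hm hab n).1, (not_surjective_of_mulEquiv hm hab n).2,
      not_arisesFromLambda2 (hrange n), hrange n⟩⟩
  rw [hper, Set.pair_eq_singleton, Subgroup.zpowers_eq_closure]

end CuspedPresentation

end TriangleRep

theorem mainTheorem3 :
    (∀ n : ℕ, 4 ≤ n → ¬ 3 ∣ n →
      Nonempty (Abelianization (TriangleRep.Lambda2 3 3 (n : ℕ∞)) ≃* Multiplicative (ZMod 3))) ∧
    (∀ n : ℕ, 4 ≤ n → 3 ∣ n →
      Nonempty (Abelianization (TriangleRep.Lambda2 3 3 (n : ℕ∞)) ≃*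
        Multiplicative (ZMod 3 × ZMod 3))) ∧
    Nonempty (Abelianization (TriangleRep.Lambda2 3 3 ⊤) ≃* Multiplicative (ZMod 3 × ZMod 3)) ∧
    (TriangleRep.CuspedPresentation.IsBoundaryUnipotent TriangleRep.rep045 ∧
      TriangleRep.CuspedPresentation.IsRankOneBoundaryUnipotent TriangleRep.rep045 ∧
      TriangleRep.CuspedPresentation.FactorsThroughFilling TriangleRep.rep045 5 1 ∧
      Nonempty (Abelianization (TriangleRep.m045.FillingPi1 5 1) ≃* Multiplicative (ZMod 14)) ∧
      ∀ n : ℕ∞, 4 ≤ n →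
        (∀ f : Abelianization (TriangleRep.m045.FillingPi1 5 1) →*
          Abelianization (TriangleRep.Lambda2 3 3 n), ¬ Function.Surjective f) ∧
        (∀ f : TriangleRep.m045.FillingPi1 5 1 →* TriangleRep.Lambda2 3 3 n,
          ¬ Function.Surjective f) ∧
        ¬ TriangleRep.CuspedPresentation.ArisesFromLambda2 TriangleRep.rep045 n ∧
        (∀ δ : TriangleRep.Lambda2 3 3 n →* TriangleRep.PU21, TriangleRep.rep045.range ≠ δ.range)) ∧
    (TriangleRep.CuspedPresentation.IsBoundaryUnipotent TriangleRep.rep035 ∧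
      TriangleRep.CuspedPresentation.IsRankOneBoundaryUnipotent TriangleRep.rep035 ∧
      TriangleRep.CuspedPresentation.FactorsThroughFilling TriangleRep.rep035 3 (-1) ∧
      Nonempty (Abelianization (TriangleRep.m035.FillingPi1 3 (-1)) ≃* Multiplicative (ZMod 20)) ∧
      ∀ n : ℕ∞, 4 ≤ n →
        (∀ f : Abelianization (TriangleRep.m035.FillingPi1 3 (-1)) →*
          Abelianization (TriangleRep.Lambda2 3 3 n), ¬ Function.Surjective f) ∧
        (∀ f : TriangleRep.m035.FillingPi1 3 (-1) →* TriangleRep.Lambda2 3 3 n,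
          ¬ Function.Surjective f) ∧
        ¬ TriangleRep.CuspedPresentation.ArisesFromLambda2 TriangleRep.rep035 n ∧
        (∀ δ : TriangleRep.Lambda2 3 3 n →* TriangleRep.PU21, TriangleRep.rep035.range ≠ δ.range)) ∧
    (TriangleRep.CuspedPresentation.IsBoundaryUnipotent TriangleRep.rep130 ∧
      TriangleRep.CuspedPresentation.IsRankOneBoundaryUnipotent TriangleRep.rep130 ∧
      TriangleRep.CuspedPresentation.FactorsThroughFilling TriangleRep.rep130 2 (-1) ∧
      Nonempty (Abelianization (TriangleRep.m130.FillingPi1 2 (-1)) ≃* Multiplicative (ZMod 16)) ∧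
      ∀ n : ℕ∞, 4 ≤ n →
        (∀ f : Abelianization (TriangleRep.m130.FillingPi1 2 (-1)) →*
          Abelianization (TriangleRep.Lambda2 3 3 n), ¬ Function.Surjective f) ∧
        (∀ f : TriangleRep.m130.FillingPi1 2 (-1) →* TriangleRep.Lambda2 3 3 n,
          ¬ Function.Surjective f) ∧
        ¬ TriangleRep.CuspedPresentation.ArisesFromLambda2 TriangleRep.rep130 n ∧
        (∀ δ : TriangleRep.Lambda2 3 3 n →* TriangleRep.PU21, TriangleRep.rep130.range ≠ δ.range)) := by
  refine ⟨fun n _ => TriangleRep.Lambda2.abelianization_of_not_dvd n,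
    fun n _ hn => TriangleRep.Lambda2.abelianization_of_forall_dvd fun k hk => ?_,
    TriangleRep.Lambda2.abelianization_of_forall_dvd fun k hk => absurd hk.symm (by simp),
    TriangleRep.CuspedPresentation.rankOne_filling_properties
      -- The exponents `-5`, `3` and `2` come from solving the slope relations for the longitude.
      TriangleRep.isUnipotent_meridian_m045 (-5) ?_ TriangleRep.slope_rep045 (by norm_num)
      TriangleRep.abelianization_filling_m045 TriangleRep.range_rep045_ne,
    TriangleRep.CuspedPresentation.rankOne_filling_properties
      TriangleRep.isUnipotent_meridian_m035 3 ?_ TriangleRep.slope_rep035 (by norm_num)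
      TriangleRep.abelianization_filling_m035 TriangleRep.range_rep035_ne,
    TriangleRep.CuspedPresentation.rankOne_filling_properties
      TriangleRep.isUnipotent_meridian_m130 2 ?_ TriangleRep.slope_rep130 (by norm_num)
      TriangleRep.abelianization_filling_m130 TriangleRep.range_rep130_ne⟩
  · obtain rfl : n = k := by exact_mod_cast hk
    exact hn
  · have h := TriangleRep.slope_rep045
    rw [zpow_one] at h
    rw [zpow_neg]
    exact eq_inv_of_mul_eq_one_right h
  · have h := TriangleRep.slope_rep035
    rw [zpow_neg_one] at h
    exact (mul_inv_eq_one.mp h).symm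
  · have h := TriangleRep.slope_rep130
    rw [zpow_neg_one] at h
    exact (mul_inv_eq_one.mp h).symm
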